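/- Let $\mathcal A$ be an artinian abelian category, i.e. an abelian category in which every descending chain of subobjects of any object is stationary, and let $S$ be a set of prime numbers. Let $\mathcal A_S$ be the full subcategory of $\mathcal A$ whose objects are the $S$-primary torsion objects, that is, those $X$ such that $n\cdot \mathrm{id}_X=0$ for some positive integer $n$ all of whose prime factors belong to $S$; this is a Serre subcategory of $\mathcal A$. Let $\mathcal A/\mathcal A_S$ be the quotient abelian category, i.e. the localization of $\mathcal A$ at the morphisms whose kernel and cokernel belong to $\mathcal A_S$. For an abelian category $\mathcal C$, let $\mathrm{hd}(\mathcal C)\in\{0,1,2,\dots\}\cup\{\infty\}$ denote its homological dimension: the smallest integer $n\ge 0$ such that $\mathrm{Ext}^i_{\mathcal C}(X,Y)=0$ for all objects $X,Y$ of $\mathcal C$ and all $i>n$, or $\infty$ if there is no such $n$. Then $$\mathrm{hd}(\mathcal A)=\max\bigl(\mathrm{hd}(\mathcal A_S),\,\mathrm{hd}(\mathcal A/\mathcal A_S)\bigr).$$ -/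

import Mathlib

universe v u

namespace TorsionHd

open CategoryTheory CategoryTheory.Limits

/-- The homological dimension of an abelian category, as an element of `ℕ ∪ {∞}`: the smallest
natural number `n` such that `Ext^i(X, Y) = 0` for all objects `X`, `Y` and all `i > n`, and
`∞` if no such `n` exists. -/
noncomputable def hd (C : Type u) [Category.{v} C] [Abelian C] : ℕ∞ :=
  letI := HasExt.standard C
  ⨅ (n : ℕ) (_ : ∀ (X Y : C) (i : ℕ), n < i → Subsingleton (Abelian.Ext.{max u v} X Y i)),
    (n : ℕ∞)

/-- The set `⟨S⟩` of positive integers all of whose prime factors belong to `S`. -/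
def primeSpan (S : Set Nat.Primes) : Set ℕ :=
  {n | 0 < n ∧ ∀ p : Nat.Primes, (p : ℕ) ∣ n → p ∈ S}

/-- The property of being an `S`-torsion object: multiplication by some `n ∈ ⟨S⟩` is zero. -/
def torsion (A : Type u) [Category.{v} A] [Abelian A] (S : Set Nat.Primes) : ObjectProperty A :=
  fun X => ∃ n ∈ primeSpan S, n • 𝟙 X = 0

theorem one_mem_primeSpan (S : Set Nat.Primes) : 1 ∈ primeSpan S :=
  ⟨one_pos, fun p hp => absurd (Nat.dvd_one.1 hp) p.2.ne_one⟩

theorem mul_mem_primeSpan {S : Set Nat.Primes} {m n : ℕ} (hm : m ∈ primeSpan S)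
    (hn : n ∈ primeSpan S) : m * n ∈ primeSpan S :=
  ⟨Nat.mul_pos hm.1 hn.1, fun p hp => ((p.2.dvd_mul).1 hp).elim (hm.2 p) (hn.2 p)⟩

/-- The `S`-torsion objects form a Serre subcategory. -/
instance torsion_isSerreClass (A : Type u) [Category.{v} A] [Abelian A] (S : Set Nat.Primes) :
    (torsion A S).IsSerreClass where
  exists_zero :=
    ⟨_, isZero_zero A, 1, one_mem_primeSpan S, (isZero_zero A).eq_of_src _ _⟩
  prop_of_mono := by
    rintro X Y f _ ⟨n, hn, h⟩
    refine ⟨n, hn, ?_⟩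
    rw [← cancel_mono f]
    have : f ≫ (n • 𝟙 Y) = 0 := by rw [h, comp_zero]
    simpa [Preadditive.nsmul_comp, Preadditive.comp_nsmul] using this
  prop_of_epi := by
    rintro X Y f _ ⟨n, hn, h⟩
    refine ⟨n, hn, ?_⟩
    rw [← cancel_epi f]
    have : (n • 𝟙 X) ≫ f = 0 := by rw [h, zero_comp]
    simpa [Preadditive.nsmul_comp, Preadditive.comp_nsmul] using this
  prop_X₂_of_shortExact := by
    rintro T hT ⟨m, hm, h₁⟩ ⟨n, hn, h₃⟩
    refine ⟨m * n, mul_mem_primeSpan hm hn, ?_⟩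
    have := hT.mono_f
    have hg : (n • 𝟙 T.X₂) ≫ T.g = 0 := by
      have : T.g ≫ (n • 𝟙 T.X₃) = 0 := by rw [h₃, comp_zero]
      simpa [Preadditive.nsmul_comp, Preadditive.comp_nsmul] using this
    have hl : hT.exact.lift _ hg ≫ T.f = n • 𝟙 T.X₂ := hT.exact.lift_f _ hg
    have hf : m • T.f = 0 := by
      have : (m • 𝟙 T.X₁) ≫ T.f = 0 := by rw [h₁, zero_comp]
      simpa [Preadditive.nsmul_comp] using this
    rw [mul_smul, ← hl, ← Preadditive.comp_nsmul, hf, comp_zero]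

instance torsion_isClosedUnderFiniteProducts (A : Type u) [Category.{v} A] [Abelian A]
    (S : Set Nat.Primes) : (torsion A S).IsClosedUnderFiniteProducts := by
  have : (torsion A S).IsClosedUnderBinaryProducts := by
    refine ⟨fun X ⟨h⟩ => ?_⟩
    have e : X ≅ h.diag.obj ⟨.left⟩ ⊞ h.diag.obj ⟨.right⟩ :=
      h.isLimit.conePointUniqueUpToIso (limit.isLimit h.diag) ≪≫
        HasLimit.isoOfNatIso (diagramIsoPair h.diag) ≪≫ (biprod.isoProd _ _).symm
    exact (torsion A S).prop_of_iso e.symm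
      ((torsion A S).prop_biprod (h.prop_diag_obj _) (h.prop_diag_obj _))
  exact .mk'

/-- The `S`-primary torsion subcategory `A_S`, a full subcategory of `A`. -/
abbrev TorsionSubcategory (A : Type u) [Category.{v} A] [Abelian A] (S : Set Nat.Primes) :
    Type u :=
  (torsion A S).FullSubcategory

/-- The quotient category `A / A_S`: the localization of `A` at the morphisms whose kernel and
cokernel are `S`-torsion. -/
abbrev TorsionQuotient (A : Type u) [Category.{v} A] [Abelian A] (S : Set Nat.Primes) :
    Type u :=
  (torsion A S).isoModSerre.Localization

/-- `A / A_S` is abelian, with the preadditive structure for which the quotient functor is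
additive. -/
noncomputable instance (A : Type u) [Category.{v} A] [Abelian A] (S : Set Nat.Primes) :
    Abelian (TorsionQuotient A S) :=
  ObjectProperty.SerreClassLocalization.abelian (torsion A S).isoModSerre.Q (torsion A S)

end TorsionHd

/-! Write `⟨S⟩` for the integers with all prime factors in `S`. Among the images of the `n ∈ ⟨S⟩`
acting on an artinian object `X`, a minimal one `D` is divisible by `⟨S⟩`, and `X / D` is torsion
(`exists_divisible_subobject`).

Two comparisons of `Ext` follow from one induction on the degree (`mapExtAddHom_isoModTorsion`).
Divisible subobjects map to zero in torsion objects, so an epimorphism onto a torsion object stays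
epi on a torsion subobject; hence `A_S` and `A` have the same `Ext` between torsion objects. In `A /
A_S` the integers of `⟨S⟩` are invertible, and `Ext` there is that of `A` up to `⟨S⟩`-torsion. This
gives `≥`.

For `≤`, above both dimensions `Ext^i` in `A` vanishes on torsion objects and is `⟨S⟩`-torsion.
Dévissage of both arguments along `D → X → X / D` reduces to divisible and torsion pieces;
multiplication by `m` on a divisible piece then reduces to its `m`-torsion, in the same degree `i`
(`ext_eq_zero_of_torsion`). -/

namespace CategoryTheory

open Limits Abelian

universe w v₁ u₁

/-! ### Effaceability of `Ext` in positive degrees -/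

section Effaceable

variable {C : Type u₁} [Category.{v₁} C] [Abelian C]

/-- Here `L.X 0` is its own homology, which the cycles of `K` already reach. -/
lemma epi_f_zero_of_quasiIso {K L : CochainComplex C ℤ} (s : K ⟶ L) [QuasiIso s]
    (h : L.d (-1) 0 = 0) (h' : L.d 0 1 = 0) : Epi (s.f 0) := by
  have hL : IsIso (L.homologyπ 0) := L.isIso_homologyπ (-1) 0 (by simp) h
  have hi : IsIso (L.iCycles 0) := L.isIso_iCycles 0 1 (by simp) h'
  have h₁ : Epi (HomologicalComplex.cyclesMap s 0 ≫ L.homologyπ 0) := by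
    rw [← HomologicalComplex.homologyπ_naturality]
    exact epi_comp _ _
  have h₂ : Epi (HomologicalComplex.cyclesMap s 0) := by
    have : HomologicalComplex.cyclesMap s 0 =
        (HomologicalComplex.cyclesMap s 0 ≫ L.homologyπ 0) ≫ inv (L.homologyπ 0) := by simp
    rw [this]
    exact epi_comp _ _
  have h₃ : Epi (K.iCycles 0 ≫ s.f 0) := by
    rw [← HomologicalComplex.cyclesMap_i]
    exact epi_comp _ _
  exact epi_of_epi (K.iCycles 0) _

/-- Since `K` vanishes in positive degrees, the identity of `K.X 0` is a chain map from the complex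
`K.X 0` concentrated in degree 0 to `K`. -/
lemma exists_epi_single_map_eq_comp {K : CochainComplex C ℤ} [K.IsStrictlyLE 0] {X : C}
    (s : K ⟶ (HomologicalComplex.single C (.up ℤ) 0).obj X) (hs : QuasiIso s) :
    ∃ (p : K.X 0 ⟶ X) (t : (HomologicalComplex.single C (.up ℤ) 0).obj (K.X 0) ⟶ K),
      Epi p ∧ (HomologicalComplex.single C (.up ℤ) 0).map p = t ≫ s := by
  have hK : ∀ j, (ComplexShape.up ℤ).Rel 0 j → 𝟙 (K.X 0) ≫ K.d 0 j = 0 := fun j hj ↦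
    (K.isZero_of_isStrictlyLE 0 j (by simp at hj; lia)).eq_of_tgt _ _
  obtain ⟨p, hp⟩ := (HomologicalComplex.single C (.up ℤ) 0).map_surjective
    (HomologicalComplex.mkHomFromSingle (𝟙 (K.X 0)) hK ≫ s)
  refine ⟨p, _, ?_, hp⟩
  have := epi_f_zero_of_quasiIso s (HomologicalComplex.single_obj_d ..)
    (HomologicalComplex.single_obj_d ..)
  have h := HomologicalComplex.congr_hom hp 0
  rw [HomologicalComplex.single_map_f_self, HomologicalComplex.comp_f,
    HomologicalComplex.mkHomFromSingle_f, Category.comp_id, cancel_epi, Iso.comp_inv_eq] at h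
  rw [h]
  exact epi_comp _ _

open _root_.DerivedCategory in
attribute [local instance] HasDerivedCategory.standard in
/-- An `Ext`-class of positive degree is annihilated by pulling back along a suitable
epimorphism. -/
lemma Abelian.Ext.exists_epi_mk₀_comp_eq_zero [HasExt.{w} C] {X Y : C} {n : ℕ}
    (e : Ext.{w} X Y (n + 1)) :
    ∃ (Z : C) (p : Z ⟶ X), Epi p ∧ (Ext.mk₀ p).comp e (zero_add _) = 0 := by
  let KX := (CochainComplex.singleFunctor C 0).obj X
  let KY := (CochainComplex.singleFunctor C 0).obj Y
  let e' : Q.obj KX ⟶ (Q.obj KY)⟦((n + 1 : ℕ) : ℤ)⟧ := e.hom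
  have : KX.IsStrictlyLE 0 := inferInstanceAs
    (CochainComplex.IsStrictlyLE ((HomologicalComplex.single C (.up ℤ) 0).obj X) 0)
  -- The class becomes a roof whose apex `K` lives in degrees `≤ 0`. Restricted to `K.X 0` in degree
  -- 0, the leg `g` vanishes, as its target sits in degree `-(n + 1)`.
  obtain ⟨K, _, s, hs, g, fac⟩ := right_fac_of_isStrictlyLE
    (e' ≫ (Q.commShiftIso ((n + 1 : ℕ) : ℤ)).inv.app KY) 0
  rw [isIso_Q_map_iff_quasiIso] at hs
  obtain ⟨p, t, hp, h⟩ := exists_epi_single_map_eq_comp s hs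
  let t' : (CochainComplex.singleFunctor C 0).obj (K.X 0) ⟶ K := t
  have hp' : (CochainComplex.singleFunctor C 0).map p = t' ≫ (show K ⟶ KX from s) := h
  have hg : t' ≫ g = 0 := by
    apply HomologicalComplex.from_single_hom_ext
    refine IsZero.eq_of_tgt ?_ _ _
    exact HomologicalComplex.isZero_single_obj_X (.up ℤ) 0 Y (0 + ((n + 1 : ℕ) : ℤ)) (by lia)
  refine ⟨K.X 0, p, hp, ?_⟩
  apply Ext.ext
  rw [Ext.comp_hom, Ext.mk₀_hom, Ext.zero_hom, ShiftedHom.mk₀_comp]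
  have h₁ : Q.map ((CochainComplex.singleFunctor C 0).map p) ≫ e' = 0 := by
    rw [← cancel_mono ((Q.commShiftIso ((n + 1 : ℕ) : ℤ)).inv.app KY), Category.assoc, fac, hp',
      Functor.map_comp, Limits.zero_comp]
    have := (isIso_Q_map_iff_quasiIso C s).2 hs
    rw [Category.assoc, IsIso.hom_inv_id_assoc, ← Functor.map_comp, hg, Functor.map_zero]
  exact h₁

end Effaceable

end CategoryTheory

namespace CategoryTheory

open Limits Abelian

universe w w' v₁ v₂ u₁ u₂

/-! ### `Ext` under exact functors, up to torsion -/

namespace Abelian.Ext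

variable {C : Type u₁} [Category.{v₁} C] [Abelian C] [HasExt.{w} C]

lemma comp_nsmul {X Y Z : C} {a b c : ℕ} (m : ℕ) (α : Ext.{w} X Y a) (β : Ext.{w} Y Z b)
    (h : a + b = c) : α.comp (m • β) h = m • α.comp β h :=
  map_nsmul (bilinearComp X Y Z a b c h α) m β

lemma nsmul_comp {X Y Z : C} {a b c : ℕ} (m : ℕ) (α : Ext.{w} X Y a) (β : Ext.{w} Y Z b)
    (h : a + b = c) : (m • α).comp β h = m • α.comp β h :=
  map_nsmul ((bilinearComp X Y Z a b c h).flip β) m α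

lemma comp_sub {X Y Z : C} {a b c : ℕ} (α : Ext.{w} X Y a) (β β' : Ext.{w} Y Z b)
    (h : a + b = c) : α.comp (β - β') h = α.comp β h - α.comp β' h :=
  map_sub (bilinearComp X Y Z a b c h α) β β'

lemma mk₀_nsmul {X Y : C} (m : ℕ) (f : X ⟶ Y) : mk₀ (m • f) = m • mk₀.{w} f :=
  map_nsmul (addEquiv₀.symm : (X ⟶ Y) ≃+ Ext.{w} X Y 0) m f

lemma nsmul_id_comp {X Y : C} {n : ℕ} (m : ℕ) (e : Ext.{w} X Y n) :
    (mk₀ (m • 𝟙 X)).comp e (zero_add n) = m • e := by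
  rw [mk₀_nsmul, nsmul_comp, mk₀_id_comp]

lemma comp_nsmul_id {X Y : C} {n : ℕ} (m : ℕ) (e : Ext.{w} X Y n) :
    e.comp (mk₀ (m • 𝟙 Y)) (add_zero n) = m • e := by
  rw [mk₀_nsmul, comp_nsmul, comp_mk₀_id]

end Abelian.Ext

namespace Functor

variable {C : Type u₁} [Category.{v₁} C] [Abelian C] [HasExt.{w} C]
  {D : Type u₂} [Category.{v₂} D] [Abelian D] [HasExt.{w'} D]
  (F : C ⥤ D) [F.Additive] [PreservesFiniteLimits F] [PreservesFiniteColimits F]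

variable {F} in
lemma exists_mk₀_map_f_comp_eq {S : ShortComplex C} (hS : S.ShortExact) {Y : D} {n n' : ℕ}
    (f : Ext.{w'} (F.obj S.X₁) Y n) (hn : 1 + n = n')
    (hf : (hS.extClass.mapExactFunctor F).comp f hn = 0) :
    ∃ g : Ext.{w'} (F.obj S.X₂) Y n, (Ext.mk₀ (F.map S.f)).comp g (zero_add n) = f := by
  rw [Ext.mapExactFunctor_extClass] at hf
  exact Ext.contravariant_sequence_exact₁ (hS.map_of_exact F) Y f hn hf

variable {F} in
lemma exists_mapExactFunctor_extClass_comp_eq {S : ShortComplex C} (hS : S.ShortExact) {Y : D}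
    {n n' : ℕ} (e : Ext.{w'} (F.obj S.X₃) Y n') (hn : 1 + n = n')
    (he : (Ext.mk₀ (F.map S.g)).comp e (zero_add n') = 0) :
    ∃ f : Ext.{w'} (F.obj S.X₁) Y n, (hS.extClass.mapExactFunctor F).comp f hn = e := by
  rw [Ext.mapExactFunctor_extClass]
  exact Ext.contravariant_sequence_exact₃ (hS.map_of_exact F) Y e he hn

/-- If an exact functor `F` induces isomorphisms on `Hom`-groups up to `M`-torsion, and if every
epimorphism to `F.obj X` is dominated by the image of an epimorphism to `X`, then `F` induces
isomorphisms on all `Ext`-groups up to `M`-torsion. -/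
theorem mapExtAddHom_isoModTorsion (M : Submonoid ℕ)
  (hinj : ∀ ⦃X Y : C⦄ (f : X ⟶ Y), F.map f = 0 → ∃ m ∈ M, m • f = 0)
  (hsurj : ∀ ⦃X Y : C⦄ (g : F.obj X ⟶ F.obj Y), ∃ m ∈ M, ∃ f : X ⟶ Y, F.map f = m • g)
  (hepi : ∀ ⦃X : C⦄ ⦃W : D⦄ (p : W ⟶ F.obj X), Epi p →
    ∃ (Z : C) (q : Z ⟶ X) (r : F.obj Z ⟶ W), Epi q ∧ r ≫ p = F.map q)
    (n : ℕ) :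
    (∀ (X Y : C) (e : Ext.{w} X Y n), F.mapExtAddHom X Y n e = (0 : Ext.{w'} _ _ n) →
      ∃ m ∈ M, m • e = 0) ∧
    (∀ (X Y : C) (e : Ext.{w'} (F.obj X) (F.obj Y) n), ∃ m ∈ M, ∃ e' : Ext.{w} X Y n,
      F.mapExtAddHom X Y n e' = m • e) := by
  induction n with
  | zero =>
    constructor
    · intro X Y e he
      obtain ⟨f, rfl⟩ := (Ext.mk₀_bijective X Y).2 e
      rw [mapExtAddHom_apply, Ext.mapExactFunctor_mk₀, Ext.mk₀_eq_zero_iff] at he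
      obtain ⟨m, hm, h⟩ := hinj f he
      exact ⟨m, hm, by rw [← Ext.mk₀_nsmul, h, Ext.mk₀_zero]⟩
    · intro X Y e
      obtain ⟨g, rfl⟩ := (Ext.mk₀_bijective _ _).2 e
      obtain ⟨m, hm, f, hf⟩ := hsurj g
      exact ⟨m, hm, Ext.mk₀ f, by
        rw [mapExtAddHom_apply, Ext.mapExactFunctor_mk₀, hf, Ext.mk₀_nsmul]⟩
  | succ n ih =>
    obtain ⟨ih₁, ih₂⟩ := ih
    constructor
    · intro X Y e he
      obtain ⟨Z, p, _, hp⟩ := e.exists_epi_mk₀_comp_eq_zero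
      let S := ShortComplex.mk _ _ (kernel.condition p)
      have hS : S.ShortExact := { exact := ShortComplex.exact_kernel p }
      obtain ⟨f, hf⟩ := Ext.contravariant_sequence_exact₃ hS Y e hp (add_comm 1 n)
      obtain ⟨g, hg⟩ := exists_mk₀_map_f_comp_eq hS (f.mapExactFunctor F) (add_comm 1 n) (by
        rw [← Ext.mapExactFunctor_comp, hf]
        exact he)
      obtain ⟨m, hm, g', hg'⟩ := ih₂ _ _ g
      -- Both terms have the same image under `F`, and the second dies when composed with the
      -- extension class.
      obtain ⟨m', hm', h⟩ := ih₁ S.X₁ Y (m • f - (Ext.mk₀ S.f).comp g' (zero_add n)) (by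
        rw [_root_.map_sub, _root_.map_nsmul, mapExtAddHom_apply, mapExtAddHom_apply, ← hg,
          Ext.mapExactFunctor_comp, Ext.mapExactFunctor_mk₀, ← mapExtAddHom_apply, hg',
          Ext.comp_nsmul, sub_self])
      refine ⟨m' * m, M.mul_mem hm' hm, ?_⟩
      have h₀ := congr_arg (fun x ↦ hS.extClass.comp x (add_comm 1 n)) h
      rw [Ext.comp_nsmul, Ext.comp_sub, Ext.comp_nsmul, hf, hS.extClass_comp_assoc,
        sub_zero, Ext.comp_zero, smul_smul] at h₀
      exact h₀
    · intro X Y e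
      obtain ⟨W, p, hp, hpe⟩ := e.exists_epi_mk₀_comp_eq_zero
      -- The effacing epimorphism must come from `C` so that its kernel does too and the induction
      -- hypothesis applies.
      obtain ⟨Z, q, r, _, hq⟩ := hepi p hp
      let S := ShortComplex.mk _ _ (kernel.condition q)
      have hS : S.ShortExact := { exact := ShortComplex.exact_kernel q }
      obtain ⟨f, hf⟩ := exists_mapExactFunctor_extClass_comp_eq (F := F) hS e (add_comm 1 n) (by
        rw [← hq, ← Ext.mk₀_comp_mk₀_assoc, hpe, Ext.comp_zero])
      obtain ⟨m, hm, g, hg⟩ := ih₂ S.X₁ Y f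
      refine ⟨m, hm, hS.extClass.comp g (add_comm 1 n), ?_⟩
      rw [mapExtAddHom_apply, Ext.mapExactFunctor_comp, ← mapExtAddHom_apply _ _ _ _ g, hg,
        Ext.comp_nsmul, hf]

end Functor

end CategoryTheory

/-! ### Torsion and divisibility in artinian objects -/

namespace TorsionHd

open CategoryTheory CategoryTheory.Limits CategoryTheory.Abelian

/-- The integers all of whose prime factors belong to `S`, as a submonoid of `ℕ`. -/
def primeSpanSubmonoid (S : Set Nat.Primes) : Submonoid ℕ where
  carrier := primeSpan S
  one_mem' := one_mem_primeSpan S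
  mul_mem' := mul_mem_primeSpan

variable {A : Type u} [Category.{v} A] [Abelian A] {S : Set Nat.Primes}

lemma torsion_of_nsmul_eq_zero {X Y : A} (f : X ⟶ Y) [Mono f] {n : ℕ} (hn : n ∈ primeSpan S)
    (h : n • f = 0) : torsion A S X :=
  ⟨n, hn, by rw [← cancel_mono f, Preadditive.nsmul_comp, Category.id_comp, h, zero_comp]⟩

lemma torsion_of_nsmul_eq_zero' {X Y : A} (f : X ⟶ Y) [Epi f] {n : ℕ} (hn : n ∈ primeSpan S)
    (h : n • f = 0) : torsion A S Y :=
  ⟨n, hn, by rw [← cancel_epi f, Preadditive.comp_nsmul, Category.comp_id, h, comp_zero]⟩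

lemma isoModSerre_nsmul_id (X : A) {n : ℕ} (hn : n ∈ primeSpan S) :
    (torsion A S).isoModSerre (n • 𝟙 X) := by
  refine ⟨torsion_of_nsmul_eq_zero (kernel.ι (n • 𝟙 X)) hn ?_,
    torsion_of_nsmul_eq_zero' (cokernel.π (n • 𝟙 X)) hn ?_⟩
  · simpa using kernel.condition (n • 𝟙 X)
  · have h := cokernel.condition (n • 𝟙 X)
    rwa [Preadditive.nsmul_comp, Category.id_comp] at h

/-- An artinian object `X` contains a divisible subobject `D` with torsion quotient: more
precisely, multiplication by some `N ∈ ⟨S⟩` on `X` factors through `D`. -/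
lemma exists_divisible_subobject (S : Set Nat.Primes) (X : A) [IsArtinianObject X] :
    ∃ (D : A) (i : D ⟶ X) (e : X ⟶ D) (N : ℕ), Mono i ∧ N ∈ primeSpan S ∧ e ≫ i = N • 𝟙 X ∧
      ∀ m ∈ primeSpan S, Epi (m • 𝟙 D) := by
  let T : Set (Subobject X) := {B | ∃ n ∈ primeSpan S, ∃ e : X ⟶ (B : A), Epi e ∧
    e ≫ B.arrow = n • 𝟙 X}
  have hT : T.Nonempty := by
    refine ⟨⊤, 1, one_mem_primeSpan S, inv (⊤ : Subobject X).arrow, inferInstance, by simp⟩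
  obtain ⟨B, ⟨N, hN, e, _, he⟩, hB⟩ := (wellFounded_lt (α := Subobject X)).has_min T hT
  refine ⟨B, B.arrow, e, N, inferInstance, hN, he, fun m hm ↦ ?_⟩
  let f : X ⟶ (B : A) := e ≫ (m • 𝟙 (B : A))
  let j : Abelian.image f ⟶ X := Abelian.image.ι f ≫ B.arrow
  have hj : Subobject.mk j ≤ B := Subobject.mk_le_of_comm (Abelian.image.ι f) rfl
  have hjT : Subobject.mk j ∈ T := by
    refine ⟨m * N, mul_mem_primeSpan hm hN,
      Abelian.factorThruImage f ≫ (Subobject.underlyingIso j).inv, epi_comp _ _, ?_⟩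
    simp [j, f, he, mul_smul]
  -- By minimality the image of `m * N` is all of `B`, so `m` is epi on `B`.
  have hle : B ≤ Subobject.mk j := by
    by_contra h
    exact hB _ hjT (lt_of_le_not_ge hj h)
  have hs : Subobject.ofLEMk B j hle ≫ Abelian.image.ι f = 𝟙 _ := by
    rw [← cancel_mono B.arrow]
    simp [j]
  have : IsSplitEpi (Abelian.image.ι f) := ⟨⟨⟨_, hs⟩⟩⟩
  have hf : Epi f := by
    rw [← Abelian.image.fac f]
    exact epi_comp _ _
  exact epi_of_epi e _

lemma torsion_cokernel_of_comp_eq_nsmul {X D : A} {i : D ⟶ X} {e : X ⟶ D} {N : ℕ}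
    (hN : N ∈ primeSpan S) (h : e ≫ i = N • 𝟙 X) : torsion A S (cokernel i) := by
  refine torsion_of_nsmul_eq_zero' (cokernel.π i) hN ?_
  have : N • cokernel.π i = (N • 𝟙 X) ≫ cokernel.π i := by simp
  rw [this, ← h, Category.assoc, cokernel.condition, comp_zero]

/-- In an artinian category, every epimorphism to a torsion object restricts to an epimorphism
from a torsion object. -/
lemma exists_torsion_epi {W T : A} [IsArtinianObject W] (p : W ⟶ T) [Epi p]
    (hT : torsion A S T) : ∃ (Z : A) (r : Z ⟶ W), torsion A S Z ∧ Epi (r ≫ p) := by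
  obtain ⟨n, hn, hT⟩ := hT
  obtain ⟨D, i, e, N, _, hN, he, hD⟩ := exists_divisible_subobject S W
  have hie : i ≫ e = N • 𝟙 D := by
    rw [← cancel_mono i, Category.assoc, he]
    simp
  have hip : i ≫ p = 0 := by
    have := hD n hn
    rw [← cancel_epi (n • 𝟙 D), comp_zero]
    have h : (i ≫ p) ≫ (n • 𝟙 T) = 0 := by rw [hT, comp_zero]
    simpa using h
  have : Epi (i ≫ e) := hie ▸ hD N hN
  have : Epi e := epi_of_epi i e
  refine ⟨kernel e, kernel.ι e, torsion_of_nsmul_eq_zero (kernel.ι e) hN ?_, ?_⟩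
  · have : N • kernel.ι e = kernel.ι e ≫ (N • 𝟙 W) := by simp
    rw [this, ← he, kernel.condition_assoc, zero_comp]
  -- Morally `W = kernel e + D` and `p` kills `D`: if `p ≫ g` vanishes on `kernel e`, it factors
  -- through `e`, and restricting to `D` kills the factor.
  · rw [Preadditive.epi_iff_cancel_zero]
    intro G g hg
    obtain ⟨h, hh⟩ : ∃ h, e ≫ h = p ≫ g :=
      ⟨_, (Abelian.epiIsCokernelOfKernel _ (kernelIsKernel e)).fac
        (CokernelCofork.ofπ (p ≫ g) (by simpa using hg)) WalkingParallelPair.one⟩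
    have h₀ : h = 0 := by
      rw [← cancel_epi (i ≫ e), Category.assoc, hh, reassoc_of% hip, zero_comp, comp_zero]
    rw [← cancel_epi p, ← hh, h₀, comp_zero, comp_zero]

instance : PreservesFiniteLimits (torsion A S).ι := by
  rw [((Functor.preservesFiniteLimits_tfae (torsion A S).ι).out 3 2 :)]
  intro _ _ f
  exact (torsion A S).preservesKernels_ι f

instance : PreservesFiniteColimits (torsion A S).ι := by
  rw [((Functor.preservesFiniteColimits_tfae (torsion A S).ι).out 3 2 :)]
  intro _ _ f
  exact (torsion A S).preservesCokernels_ι f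

/-! ### Morphisms of the quotient category -/

section Quotient

variable (A S) in
/-- The quotient functor `A ⥤ A / A_S`. -/
abbrev quotientFunctor : A ⥤ TorsionQuotient A S := (torsion A S).isoModSerre.Q

instance : PreservesFiniteLimits (quotientFunctor A S) :=
  ObjectProperty.SerreClassLocalization.preservesFiniteLimits _ (torsion A S)

instance : PreservesFiniteColimits (quotientFunctor A S) :=
  ObjectProperty.SerreClassLocalization.preservesFiniteColimits _ (torsion A S)

lemma isIso_nsmul_id (X : TorsionQuotient A S) {n : ℕ} (hn : n ∈ primeSpan S) :
    IsIso (n • 𝟙 X) := by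
  have := Localization.essSurj (quotientFunctor A S) (torsion A S).isoModSerre
  let e := (quotientFunctor A S).objObjPreimageIso X
  have h := Localization.inverts (quotientFunctor A S) (torsion A S).isoModSerre _
    (isoModSerre_nsmul_id ((quotientFunctor A S).objPreimage X) hn)
  rw [Functor.map_nsmul, CategoryTheory.Functor.map_id] at h
  have : n • 𝟙 X = e.inv ≫ (n • 𝟙 _) ≫ e.hom := by simp
  rw [this]
  infer_instance

lemma exists_comp_eq_nsmul_of_epiModSerre {X Y : A} (f : X ⟶ Y)
    (hf : (torsion A S).epiModSerre f) :
    ∃ n ∈ primeSpan S, ∃ e : Y ⟶ Abelian.image f, e ≫ Abelian.image.ι f = n • 𝟙 Y := by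
  obtain ⟨n, hn, h⟩ := hf
  refine ⟨n, hn, kernel.lift _ (n • 𝟙 Y) ?_, kernel.lift_ι _ _ _⟩
  have h : cokernel.π f ≫ (n • 𝟙 _) = 0 := by rw [h, comp_zero]
  simpa using h

/-- If `a` kills the cokernel and `b` the kernel, then `a` maps `Y` into the image of `f`, and `b •
𝟙 X` descends to a map from that image back to `X`. -/
lemma exists_comp_eq_nsmul_of_isoModSerre {X Y : A} (f : X ⟶ Y)
    (hf : (torsion A S).isoModSerre f) :
    ∃ n ∈ primeSpan S, ∃ g : Y ⟶ X, g ≫ f = n • 𝟙 Y := by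
  obtain ⟨a, ha, e, he⟩ := exists_comp_eq_nsmul_of_epiModSerre f hf.2
  obtain ⟨b, hb, h⟩ := hf.1
  have hb' : kernel.ι f ≫ (b • 𝟙 X) = 0 := by
    have h : (b • 𝟙 _) ≫ kernel.ι f = 0 := by rw [h, zero_comp]
    simpa using h
  let u : Abelian.image f ⟶ X := (Abelian.coimageIsoImage f).inv ≫ cokernel.desc _ (b • 𝟙 X) hb'
  have hu : Abelian.factorThruImage f ≫ u = b • 𝟙 X := by
    have : Abelian.factorThruImage f = Abelian.coimage.π f ≫ (Abelian.coimageIsoImage f).hom := by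
      rw [← cancel_mono (Abelian.image.ι f)]
      simp
    rw [this]
    simp [u]
  have hu' : u ≫ f = b • Abelian.image.ι f := by
    rw [← cancel_epi (Abelian.factorThruImage f), reassoc_of% hu]
    simp
  exact ⟨b * a, mul_mem_primeSpan hb ha, e ≫ u, by
    rw [Category.assoc, hu', Preadditive.comp_nsmul, he, mul_smul]⟩

lemma exists_nsmul_eq_zero_of_map_eq_zero {X Y : A} (f : X ⟶ Y)
    (hf : (quotientFunctor A S).map f = 0) : ∃ m ∈ primeSpanSubmonoid S, m • f = 0 := by
  obtain ⟨n, hn, h⟩ :=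
    (ObjectProperty.SerreClassLocalization.map_eq_zero_iff _ (torsion A S) f).1 hf
  refine ⟨n, hn, ?_⟩
  rw [← Abelian.image.fac f, ← Preadditive.comp_nsmul, ← Category.id_comp (Abelian.image.ι f),
    ← Preadditive.nsmul_comp, h, zero_comp, comp_zero]

lemma exists_map_eq_nsmul {X Y : A}
    (g : (quotientFunctor A S).obj X ⟶ (quotientFunctor A S).obj Y) :
    ∃ m ∈ primeSpanSubmonoid S, ∃ f : X ⟶ Y, (quotientFunctor A S).map f = m • g := by
  obtain ⟨φ, hφ⟩ := Localization.exists_rightFraction (quotientFunctor A S)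
    (torsion A S).isoModSerre g
  obtain ⟨n, hn, t, ht⟩ := exists_comp_eq_nsmul_of_isoModSerre φ.s φ.hs
  refine ⟨n, hn, t ≫ φ.f, ?_⟩
  have h : (quotientFunctor A S).map φ.s ≫ g = (quotientFunctor A S).map φ.f := by
    rw [hφ, MorphismProperty.RightFraction.map_s_comp_map]
  rw [Functor.map_comp, ← h, ← Functor.map_comp_assoc, ht, Functor.map_nsmul, CategoryTheory.Functor.map_id,
    Preadditive.nsmul_comp, Category.id_comp]

/-- A multiple of `p` lifts to some `f` in `A`, epi only modulo torsion: its image contains a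
multiple `n` of the target. Pulling back along `n` gives a true epimorphism, and `n` is then
inverted in the quotient. -/
lemma exists_epi_map_eq_comp {X : A} {W : TorsionQuotient A S}
    (p : W ⟶ (quotientFunctor A S).obj X) (hp : Epi p) :
    ∃ (Z : A) (q : Z ⟶ X) (r : (quotientFunctor A S).obj Z ⟶ W), Epi q ∧
      r ≫ p = (quotientFunctor A S).map q := by
  have := Localization.essSurj (quotientFunctor A S) (torsion A S).isoModSerre
  let ε := (quotientFunctor A S).objObjPreimageIso W
  obtain ⟨m, hm, f, hf⟩ := exists_map_eq_nsmul (ε.hom ≫ p)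
  have hf' : Epi ((quotientFunctor A S).map f) := by
    have := isIso_nsmul_id ((quotientFunctor A S).obj X) hm
    have h : (quotientFunctor A S).map f = ε.hom ≫ p ≫ (m • 𝟙 _) := by simp [hf]
    rw [h]
    infer_instance
  rw [ObjectProperty.SerreClassLocalization.epi_map_iff _ (torsion A S)] at hf'
  obtain ⟨n, hn, e, he⟩ := exists_comp_eq_nsmul_of_epiModSerre f hf'
  let Z := pullback (Abelian.factorThruImage f) e
  let a : Z ⟶ _ := pullback.fst (Abelian.factorThruImage f) e
  let q : Z ⟶ X := pullback.snd (Abelian.factorThruImage f) e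
  have hq : a ≫ f = n • q := by
    have := pullback.condition (f := Abelian.factorThruImage f) (g := e) =≫ Abelian.image.ι f
    rw [Category.assoc, Category.assoc, Abelian.image.fac, he] at this
    simpa using this
  have hQ : ((quotientFunctor A S).map a ≫ (m • ε.hom)) ≫ p = n • (quotientFunctor A S).map q := by
    rw [← Functor.map_nsmul, ← hq, Functor.map_comp, hf]
    simp
  have := isIso_nsmul_id ((quotientFunctor A S).obj Z) hn
  refine ⟨Z, q, inv (n • 𝟙 _) ≫ (quotientFunctor A S).map a ≫ (m • ε.hom),
    inferInstanceAs (Epi (pullback.snd _ _)), ?_⟩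
  rw [Category.assoc, hQ, IsIso.inv_comp_eq]
  simp

end Quotient

end TorsionHd

/-! ### Homological dimension and dévissage -/

namespace TorsionHd

open CategoryTheory CategoryTheory.Limits CategoryTheory.Abelian

universe w v₁ u₁

section

variable {C : Type u₁} [Category.{v₁} C] [Abelian C]

lemma shortExact_kernel {X Y : C} (f : X ⟶ Y) [Epi f] :
    (ShortComplex.mk _ _ (kernel.condition f)).ShortExact :=
  { exact := ShortComplex.exact_kernel f }

lemma shortExact_cokernel {X Y : C} (f : X ⟶ Y) [Mono f] :
    (ShortComplex.mk _ _ (cokernel.condition f)).ShortExact :=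
  { exact := ShortComplex.exact_cokernel f }

variable [HasExt.{w} C]

lemma hd_le_coe_iff (n : ℕ) :
    hd C ≤ n ↔ ∀ (X Y : C) (i : ℕ), n < i → ∀ e : Ext.{w} X Y i, e = 0 := by
  have := HasExt.standard C
  have key : (∀ (X Y : C) (i : ℕ), n < i → ∀ e : Ext.{w} X Y i, e = 0) ↔
      ∀ (X Y : C) (i : ℕ), n < i → Subsingleton (Ext.{max u₁ v₁} X Y i) := by
    refine forall₄_congr fun X Y i _ ↦ ⟨fun h ↦ ?_, fun h e ↦ ?_⟩
    · have : Subsingleton (Ext.{w} X Y i) := ⟨fun a b ↦ (h a).trans (h b).symm⟩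
      exact (Ext.chgUniv.{max u₁ v₁, w} (X := X) (Y := Y) (n := i)).symm.subsingleton
    · have : Subsingleton (Ext.{w} X Y i) :=
        (Ext.chgUniv.{max u₁ v₁, w} (X := X) (Y := Y) (n := i)).subsingleton
      exact Subsingleton.elim _ _
  rw [key]
  constructor
  · intro h
    -- The strict bound `n + 1` extracts from the infimum a witness `m ≤ n`.
    have h' : hd C < (n + 1 : ℕ) := lt_of_le_of_lt h (by exact_mod_cast n.lt_succ_self)
    simp only [hd, iInf_lt_iff] at h'
    obtain ⟨m, hm, hmn⟩ := h'
    intro X Y i hi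
    exact hm X Y i (lt_of_le_of_lt (Nat.lt_succ_iff.1 (by exact_mod_cast hmn)) hi)
  · intro h
    exact iInf₂_le n h

lemma ext_eq_zero_of_shortExact {X : C} {T : ShortComplex C} (hT : T.ShortExact) {i : ℕ}
    (h₁ : ∀ e : Ext.{w} X T.X₁ i, e = 0) (h₃ : ∀ e : Ext.{w} X T.X₃ i, e = 0)
    (e : Ext.{w} X T.X₂ i) : e = 0 := by
  obtain ⟨x, rfl⟩ := Ext.covariant_sequence_exact₂ X hT e (h₃ _)
  rw [h₁ x, Ext.zero_comp]

lemma ext_eq_zero_of_shortExact' {Y : C} {T : ShortComplex C} (hT : T.ShortExact) {i : ℕ}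
    (h₁ : ∀ e : Ext.{w} T.X₁ Y i, e = 0) (h₃ : ∀ e : Ext.{w} T.X₃ Y i, e = 0)
    (e : Ext.{w} T.X₂ Y i) : e = 0 := by
  obtain ⟨x, rfl⟩ := Ext.contravariant_sequence_exact₂ hT Y e (h₁ _)
  rw [h₃ x, Ext.comp_zero]

/-- If multiplication by `m` is an epimorphism on `Y`, the `m`-torsion of `Ext(X, Y)` comes from
the `m`-torsion of `Y`. -/
lemma ext_eq_zero_of_nsmul_eq_zero {X Y : C} {i m : ℕ} [Epi (m • 𝟙 Y)]
    (h : ∀ e : Ext.{w} X (kernel (m • 𝟙 Y)) i, e = 0) (e : Ext.{w} X Y i) (he : m • e = 0) :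
    e = 0 := by
  obtain ⟨x, rfl⟩ := Ext.covariant_sequence_exact₂ X (shortExact_kernel (m • 𝟙 Y)) e
    (by rw [← he]; exact Ext.comp_nsmul_id m e)
  rw [h x, Ext.zero_comp]

/-- If multiplication by `m` is an epimorphism on `X` and zero on `Y`, then `Ext(X, Y)` embeds in
the `Ext`-group of the `m`-torsion of `X`. -/
lemma ext_eq_zero_of_nsmul_id_eq_zero {X Y : C} {i m : ℕ} [Epi (m • 𝟙 X)] (hY : m • 𝟙 Y = 0)
    (h : ∀ e : Ext.{w} (kernel (m • 𝟙 X)) Y i, e = 0) (e : Ext.{w} X Y i) : e = 0 := by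
  obtain ⟨x, rfl⟩ := Ext.contravariant_sequence_exact₂ (shortExact_kernel (m • 𝟙 X)) Y e (h _)
  refine (Ext.nsmul_id_comp m x).trans ?_
  rw [← Ext.comp_nsmul_id, hY, Ext.mk₀_zero, Ext.comp_zero]

end

variable {A : Type u} [Category.{v} A] [Abelian A] {S : Set Nat.Primes}

lemma torsion_kernel_nsmul_id (X : A) {m : ℕ} (hm : m ∈ primeSpan S) :
    torsion A S (kernel (m • 𝟙 X)) :=
  (isoModSerre_nsmul_id X hm).1

section Subcategory

variable [HasExt.{w} A] [HasExt.{w} (TorsionSubcategory A S)]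

/-- In an artinian category, the `Ext`-groups of torsion objects may be computed in the
subcategory of torsion objects. -/
lemma bijective_mapExtAddHom_torsion_ι (hA : ∀ X : A, IsArtinianObject X)
    (X Y : TorsionSubcategory A S) (i : ℕ) :
    Function.Bijective ((torsion A S).ι.mapExtAddHom X Y i :
      Ext.{w} X Y i →+ Ext.{w} X.obj Y.obj i) := by
  -- The inclusion is fully faithful, so the trivial monoid `⊥ = {1}` suffices and the comparison is
  -- a true isomorphism.
  obtain ⟨h₁, h₂⟩ := (torsion A S).ι.mapExtAddHom_isoModTorsion.{w, w} ⊥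
    (fun X Y f hf ↦ ⟨1, Submonoid.one_mem _, by
      rw [one_smul]
      exact (torsion A S).ι.map_injective (by rw [hf, Functor.map_zero])⟩)
    (fun X Y g ↦ by
      obtain ⟨f, hf⟩ := (torsion A S).ι.map_surjective g
      exact ⟨1, Submonoid.one_mem _, f, by rw [hf, one_smul]⟩)
    (fun X W p hp ↦ by
      have := hA W
      obtain ⟨Z, r, hZ, hr⟩ := exists_torsion_epi p X.property
      let q : (⟨Z, hZ⟩ : TorsionSubcategory A S) ⟶ X := (torsion A S).homMk (r ≫ p)
      exact ⟨⟨Z, hZ⟩, q, r, (torsion A S).ι.epi_of_epi_map hr, rfl⟩) i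
  refine ⟨(injective_iff_map_eq_zero _).2 fun e he ↦ ?_, fun e ↦ ?_⟩
  · obtain ⟨m, hm, h⟩ := h₁ X Y e he
    rwa [Submonoid.mem_bot.1 hm, one_smul] at h
  · obtain ⟨m, hm, e', h⟩ := h₂ X Y e
    rw [Submonoid.mem_bot.1 hm, one_smul] at h
    exact ⟨e', h⟩

end Subcategory

section Quotient

universe w'

variable [HasExt.{w'} (TorsionQuotient A S)]

lemma mapExtAddHom_quotientFunctor [HasExt.{w} A] (i : ℕ) :
    (∀ (X Y : A) (e : Ext.{w} X Y i),
      (quotientFunctor A S).mapExtAddHom X Y i e = (0 : Ext.{w'} _ _ i) →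
      ∃ m ∈ primeSpanSubmonoid S, m • e = 0) ∧
    (∀ (X Y : A) (e : Ext.{w'} ((quotientFunctor A S).obj X) ((quotientFunctor A S).obj Y) i),
      ∃ m ∈ primeSpanSubmonoid S, ∃ e' : Ext.{w} X Y i,
        (quotientFunctor A S).mapExtAddHom X Y i e' = m • e) :=
  (quotientFunctor A S).mapExtAddHom_isoModTorsion (primeSpanSubmonoid S)
    (fun _ _ f ↦ exists_nsmul_eq_zero_of_map_eq_zero f) (fun _ _ g ↦ exists_map_eq_nsmul g)
    (fun _ _ p hp ↦ exists_epi_map_eq_comp p hp) i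

lemma ext_eq_zero_of_nsmul_eq_zero_of_mem {X Y : TorsionQuotient A S} {i m : ℕ}
    (hm : m ∈ primeSpan S) (e : Ext.{w'} X Y i) (he : m • e = 0) : e = 0 := by
  have := isIso_nsmul_id X hm
  rw [← Ext.nsmul_id_comp] at he
  rw [← Ext.mk₀_id_comp e, ← IsIso.inv_hom_id (m • 𝟙 X), ← Ext.mk₀_comp_mk₀_assoc, he,
    Ext.comp_zero]

end Quotient

/-- Dévissage: in an artinian category, the groups `Ext^i` vanish as soon as they vanish on
torsion objects and are torsion. -/
lemma ext_eq_zero_of_torsion [HasExt.{w} A] (hA : ∀ X : A, IsArtinianObject X) {i : ℕ}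
    (h₁ : ∀ X Y : A, torsion A S X → torsion A S Y → ∀ e : Ext.{w} X Y i, e = 0)
    (h₂ : ∀ (X Y : A) (e : Ext.{w} X Y i), ∃ m ∈ primeSpan S, m • e = 0)
    (X Y : A) (e : Ext.{w} X Y i) : e = 0 := by
  have := hA X
  have := hA Y
  obtain ⟨D, j, f, N, _, hN, hf, hD⟩ := exists_divisible_subobject S X
  obtain ⟨D', j', f', N', _, hN', hf', hD'⟩ := exists_divisible_subobject S Y
  have hQ := torsion_cokernel_of_comp_eq_nsmul hN hf
  have hQ' := torsion_cokernel_of_comp_eq_nsmul hN' hf'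
  have hDT (T : A) (hT : torsion A S T) (e : Ext.{w} D T i) : e = 0 := by
    obtain ⟨m, hm, hm'⟩ := hT
    have := hD m hm
    exact ext_eq_zero_of_nsmul_id_eq_zero hm'
      (h₁ _ _ (torsion_kernel_nsmul_id D hm) ⟨m, hm, hm'⟩) e
  have hDD' (e : Ext.{w} D D' i) : e = 0 := by
    obtain ⟨m, hm, he⟩ := h₂ _ _ e
    have := hD' m hm
    exact ext_eq_zero_of_nsmul_eq_zero (hDT _ (torsion_kernel_nsmul_id D' hm)) e he
  have hQD' (e : Ext.{w} (cokernel j) D' i) : e = 0 := by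
    obtain ⟨m, hm, he⟩ := h₂ _ _ e
    have := hD' m hm
    exact ext_eq_zero_of_nsmul_eq_zero (h₁ _ _ hQ (torsion_kernel_nsmul_id D' hm)) e he
  exact ext_eq_zero_of_shortExact' (shortExact_cokernel j)
    (ext_eq_zero_of_shortExact (shortExact_cokernel j') hDD' (hDT _ hQ'))
    (ext_eq_zero_of_shortExact (shortExact_cokernel j') hQD' (h₁ _ _ hQ hQ')) e

lemma le_of_forall_le_coe {a b : ℕ∞} (h : ∀ n : ℕ, b ≤ n → a ≤ n) : a ≤ b := by
  induction b using ENat.recTopCoe with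
  | top => exact le_top
  | coe n => exact h n le_rfl

end TorsionHd

theorem theorem2 {A : Type u} [CategoryTheory.Category.{v} A] [CategoryTheory.Abelian A]
    (hA : ∀ X : A, CategoryTheory.IsArtinianObject X) (S : Set Nat.Primes) :
    TorsionHd.hd A =
      max (TorsionHd.hd (TorsionHd.TorsionSubcategory A S))
        (TorsionHd.hd (TorsionHd.TorsionQuotient A S)) := by
  open CategoryTheory TorsionHd in
  have := HasExt.standard A
  have := HasExt.standard (TorsionSubcategory A S)
  have := HasExt.standard (TorsionQuotient A S)
  refine le_antisymm (le_of_forall_le_coe fun n hn ↦ ?_)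
    (max_le (le_of_forall_le_coe fun n hn ↦ ?_) (le_of_forall_le_coe fun n hn ↦ ?_))
  · rw [max_le_iff, hd_le_coe_iff.{max u v}, hd_le_coe_iff.{max u v}] at hn
    rw [hd_le_coe_iff.{max u v}]
    intro X Y i hi
    refine ext_eq_zero_of_torsion (S := S) hA (fun X Y hX hY e ↦ ?_) (fun X Y e ↦ ?_) X Y
    · obtain ⟨e', rfl⟩ := (bijective_mapExtAddHom_torsion_ι hA ⟨X, hX⟩ ⟨Y, hY⟩ i).2 e
      rw [hn.1 _ _ i hi e', map_zero]
    · exact (mapExtAddHom_quotientFunctor i).1 X Y e (hn.2 _ _ i hi _)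
  · rw [hd_le_coe_iff.{max u v}] at hn ⊢
    intro X Y i hi e
    exact (bijective_mapExtAddHom_torsion_ι hA X Y i).1 ((hn _ _ i hi _).trans (map_zero _).symm)
  · rw [hd_le_coe_iff.{max u v}] at hn ⊢
    intro X Y i hi e
    -- The localization has the same objects as `A`, so equality is available rather than mere
    -- isomorphism.
    obtain ⟨X, rfl⟩ : ∃ X', (quotientFunctor A S).obj X' = X :=
      (Localization.Construction.objEquiv _).surjective X
    obtain ⟨Y, rfl⟩ : ∃ Y', (quotientFunctor A S).obj Y' = Y :=
      (Localization.Construction.objEquiv _).surjective Y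
    obtain ⟨m, hm, e', he⟩ := (mapExtAddHom_quotientFunctor (S := S) i).2 X Y e
    refine ext_eq_zero_of_nsmul_eq_zero_of_mem hm e ?_
    rw [← he, hn _ _ i hi e', map_zero]
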